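/- Let $\langle z,w\rangle=z_1\overline{w_1}+z_2\overline{w_2}-z_3\overline{w_3}$ on $\mathbb{C}^3$. Let $\mathbf{H}^2_{\mathbb{C}}\subset\mathbb{CP}^2$ be the complex hyperbolic plane, i.e. the set of complex lines spanned by vectors $z$ with $\langle z,z\rangle<0$, with the Bergman distance $d$ given by $$\cosh^2\!\left(\frac{d(u,v)}{2}\right)=\frac{\langle \mathbf u,\mathbf v\rangle\langle \mathbf v,\mathbf u\rangle}{\langle \mathbf u,\mathbf u\rangle\langle \mathbf v,\mathbf v\rangle}$$ for any lifts $\mathbf u,\mathbf v$ of $u,v$. Let $\mathrm{PU}(2,1)=\mathrm{U}(2,1)/\mathrm{U}(1)$ be its group of holomorphic isometries. A *Lagrangian plane* is a totally geodesic surface in $\mathbf{H}^2_{\mathbb{C}}$ that is isometric to the real hyperbolic plane $\mathbf{H}^2_{\mathbb{R}}$, where $\mathbf{H}^2_{\mathbb{R}}\subset\mathbf{H}^2_{\mathbb{C}}$ is the set of points with a lift in $\mathbb{R}^3$, with the restriction of $d$; equivalently, it is the image of a distance-preserving map $\mathbf{H}^2_{\mathbb{R}}\to\mathbf{H}^2_{\mathbb{C}}$.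 An element $f\in\mathrm{PU}(2,1)$ is *regular elliptic* if it fixes a point of $\mathbf{H}^2_{\mathbb{C}}$ and the matrices representing it have three distinct eigenvalues; it is *real elliptic* if it is conjugate in $\mathrm{PU}(2,1)$ to the class of $\mathrm{diag}(e^{i\theta},e^{-i\theta},1)$ for some $\theta\in\mathbb{R}$. **Theorem.** Let $f\in\mathrm{PU}(2,1)$ be regular elliptic and let $p_f\in\mathbf{H}^2_{\mathbb{C}}$ be its fixed point. Then $f$ is real elliptic if and only if there is a Lagrangian plane $L$ with $p_f\in L$ and $f(L)=L$ such that the restriction $f|_L$ is not an involution, that is, $(f|_L)^2\neq\mathrm{id}_L$. -/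

import Mathlib

open scoped Matrix LinearAlgebra.Projectivization

noncomputable section

namespace ComplexHyperbolic

/-- The Hermitian matrix `diag(1, 1, -1)` of signature `(2,1)`. -/
def H : Matrix (Fin 3) (Fin 3) ℂ := Matrix.diagonal ![1, 1, -1]

/-- The Hermitian form `⟨z, w⟩ = w* H z` on `ℂ³`. -/
def herm (z w : Fin 3 → ℂ) : ℂ := star w ⬝ᵥ (H *ᵥ z)

/-- The complex projective plane. -/
abbrev CP2 : Type := ℙ ℂ (Fin 3 → ℂ)

/-- The complex hyperbolic plane: the lines in `ℂ³` that are negative for the form. In affine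
coordinates `[w₁, w₂, 1]` it is the unit ball `|w₁|² + |w₂|² < 1`. -/
def CH2 : Set CP2 := {p | (herm p.rep p.rep).re < 0}

/-- The Bergman distance, `cosh² (d(u,v)/2) = ⟨u,v⟩⟨v,u⟩ / (⟨u,u⟩⟨v,v⟩)`. The quotient does not
depend on the lifts; only points of `CH2` are meant. -/
def bergmanDist (u v : CP2) : ℝ :=
  2 * Real.arcosh (Real.sqrt
    ((herm u.rep v.rep * herm v.rep u.rep) / (herm u.rep u.rep * herm v.rep v.rep)).re)

/-- The unitary group `U(2,1)` of the Hermitian form. -/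
def U21 : Subgroup (GL (Fin 3) ℂ) where
  carrier := {A | (A : Matrix (Fin 3) (Fin 3) ℂ)ᴴ * H * (A : Matrix (Fin 3) (Fin 3) ℂ) = H}
  one_mem' := by simp
  mul_mem' := by
    intro A B hA hB
    simp only [Set.mem_ofPred_eq] at hA hB ⊢
    calc ((A * B : GL (Fin 3) ℂ) : Matrix (Fin 3) (Fin 3) ℂ)ᴴ * H * ((A * B : GL (Fin 3) ℂ) :
          Matrix (Fin 3) (Fin 3) ℂ)
        = (B : Matrix (Fin 3) (Fin 3) ℂ)ᴴ * ((A : Matrix (Fin 3) (Fin 3) ℂ)ᴴ * H *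
          (A : Matrix (Fin 3) (Fin 3) ℂ)) * (B : Matrix (Fin 3) (Fin 3) ℂ) := by
          simp [Matrix.mul_assoc]
      _ = H := by rw [hA, hB]
  inv_mem' := by
    intro A hA
    simp only [Set.mem_ofPred_eq] at hA ⊢
    have h1 : (A : Matrix (Fin 3) (Fin 3) ℂ) * ((A⁻¹ : GL (Fin 3) ℂ) : Matrix (Fin 3) (Fin 3) ℂ)
        = 1 := by rw [← Units.val_mul, mul_inv_cancel, Units.val_one]
    have h2 : ((A⁻¹ : GL (Fin 3) ℂ) : Matrix (Fin 3) (Fin 3) ℂ)ᴴ *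
        (A : Matrix (Fin 3) (Fin 3) ℂ)ᴴ = 1 := by
      rw [← Matrix.conjTranspose_mul, h1, Matrix.conjTranspose_one]
    generalize ((A⁻¹ : GL (Fin 3) ℂ) : Matrix (Fin 3) (Fin 3) ℂ) = B at h1 h2 ⊢
    calc Bᴴ * H * B = Bᴴ * ((A : Matrix (Fin 3) (Fin 3) ℂ)ᴴ * H *
          (A : Matrix (Fin 3) (Fin 3) ℂ)) * B := by rw [hA]
      _ = (Bᴴ * (A : Matrix (Fin 3) (Fin 3) ℂ)ᴴ) * H *
          ((A : Matrix (Fin 3) (Fin 3) ℂ) * B) := by simp only [Matrix.mul_assoc]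
      _ = H := by rw [h1, h2, one_mul, mul_one]

/-- The matrix underlying an element of `U(2,1)`. -/
def toMat (A : U21) : Matrix (Fin 3) (Fin 3) ℂ := ((A : GL (Fin 3) ℂ) : Matrix _ _ ℂ)

/-- The subgroup `U(1)` of unit scalar matrices, which is the centre of `U(2,1)`. -/
def unitScalars : Subgroup U21 where
  carrier := {A | ∃ c : ℂ, ‖c‖ = 1 ∧ toMat A = c • 1}
  one_mem' := ⟨1, by simp, by simp [toMat]⟩
  mul_mem' := by
    rintro A B ⟨a, ha, hA⟩ ⟨b, hb, hB⟩
    refine ⟨a * b, by simp [ha, hb], ?_⟩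
    have h : toMat (A * B) = toMat A * toMat B := by simp [toMat]
    rw [h, hA, hB]
    simp [smul_smul, mul_comm]
  inv_mem' := by
    rintro A ⟨a, ha, hA⟩
    have ha0 : a ≠ 0 := by
      rintro rfl
      simp at ha
    refine ⟨a⁻¹, by simp [ha], ?_⟩
    have h : toMat A⁻¹ * toMat A = 1 := by
      simp only [toMat, Subgroup.coe_inv, ← Units.val_mul, inv_mul_cancel, Units.val_one]
    rw [hA, Matrix.mul_smul, mul_one] at h
    rw [← h, smul_smul, inv_mul_cancel₀ ha0, one_smul]

instance unitScalars_normal : unitScalars.Normal where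
  conj_mem := by
    rintro A ⟨a, ha, hA⟩ B
    refine ⟨a, ha, ?_⟩
    have h1 : toMat (B * A * B⁻¹) = toMat B * toMat A * toMat B⁻¹ := by
      simp [toMat]
    have h2 : toMat B * toMat B⁻¹ = 1 := by
      simp only [toMat, Subgroup.coe_inv, ← Units.val_mul, mul_inv_cancel, Units.val_one]
    rw [h1, hA, Matrix.mul_smul, mul_one, Matrix.smul_mul, h2]

/-- The group `PU(2,1)` of holomorphic isometries of the complex hyperbolic plane. -/
abbrev PU21 : Type := U21 ⧸ unitScalars

/-- The projective action of `U(2,1)` descends to `PU(2,1)`. -/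
def PU21.toPerm : PU21 →* Equiv.Perm CP2 :=
  QuotientGroup.lift unitScalars (MulAction.toPermHom U21 CP2) (by
    rintro A ⟨a, -, hA⟩
    rw [MonoidHom.mem_ker]
    ext p
    induction p using Projectivization.ind with
    | h v hv =>
      change (A : GL (Fin 3) ℂ) • Projectivization.mk ℂ v hv = Projectivization.mk ℂ v hv
      rw [Projectivization.smul_mk, Projectivization.mk_eq_mk_iff']
      refine ⟨a, ?_⟩
      have h : (A : GL (Fin 3) ℂ) • v = toMat A *ᵥ v := rfl
      rw [h, hA, Matrix.smul_mulVec, Matrix.one_mulVec])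

/-- The action of `PU(2,1)` on the projective plane: `[A] • [v] = [A v]`. -/
instance : MulAction PU21 CP2 := MulAction.compHom CP2 PU21.toPerm

/-- `f` is elliptic: it fixes a point of the complex hyperbolic plane. -/
def IsElliptic (f : PU21) : Prop := ∃ p ∈ CH2, f • p = p

/-- `f` is regular elliptic: it is elliptic and a matrix that represents it has three distinct
eigenvalues (for one representative or, equivalently, for all of them). -/
def IsRegularElliptic (f : PU21) : Prop :=
  IsElliptic f ∧ ∃ A : U21, (A : PU21) = f ∧
    {μ : ℂ | Module.End.HasEigenvalue (Matrix.toLin' (toMat A)) μ}.ncard = 3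

/-- The matrix `diag(e^{iθ}, e^{-iθ}, 1)` as an element of `U(2,1)`. -/
def realEllipticMatrix (θ : ℝ) : U21 :=
  ⟨⟨Matrix.diagonal ![Complex.exp (θ * Complex.I), Complex.exp (-(θ * Complex.I)), 1],
    Matrix.diagonal ![Complex.exp (-(θ * Complex.I)), Complex.exp (θ * Complex.I), 1],
    by
      ext i j
      fin_cases i <;> fin_cases j <;> simp [← Complex.exp_add],
    by
      ext i j
      fin_cases i <;> fin_cases j <;> simp [← Complex.exp_add]⟩,
    by
      change (Matrix.diagonal _)ᴴ * H * Matrix.diagonal _ = H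
      ext i j
      fin_cases i <;> fin_cases j <;>
        simp [H, Matrix.diagonal_conjTranspose, ← Complex.exp_conj, ← Complex.exp_add]⟩

/-- `f` is real elliptic: conjugate in `PU(2,1)` to the class of some
`diag(e^{iθ}, e^{-iθ}, 1)`. -/
def IsRealElliptic (f : PU21) : Prop := ∃ θ : ℝ, IsConj ((realEllipticMatrix θ : U21) : PU21) f

/-- The real hyperbolic plane: the points of the complex hyperbolic plane that have a lift with
real coordinates. It carries the Bergman distance of the ambient space, which is twice the
distance of curvature `-1`. -/
def RH2 : Set CP2 :=
  {p | p ∈ CH2 ∧ ∃ (x : Fin 3 → ℝ) (hx : (fun i => (x i : ℂ)) ≠ 0), p = Projectivization.mk ℂ _ hx}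

/-- A Lagrangian plane: a totally geodesic surface isometric to the real hyperbolic plane, i.e. the
image of a distance-preserving map from `RH2` to `CH2`. (Geodesics of `CH2` are unique, so such an
image contains with any two points the geodesic through them. A complex geodesic is not such an
image, since its curvature is `-1` and not `-1/4`.) -/
def IsLagrangianPlane (L : Set CP2) : Prop :=
  ∃ φ : RH2 → CH2, (∀ x y, bergmanDist (φ x) (φ y) = bergmanDist x y) ∧
    L = Set.range fun x => (φ x : CP2)

/-- `f` restricts to an involution of `L`. -/
def IsInvolutionOn (f : PU21) (L : Set CP2) : Prop := ∀ q ∈ L, f • f • q = q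

end ComplexHyperbolic

end

open scoped Matrix LinearAlgebra.Projectivization

noncomputable section

namespace ComplexHyperbolic

/-! Every Lagrangian plane is the image of `RH2` under an element of `U(2,1)`
(`IsLagrangianPlane.exists_eq_image`). The distance determines only the moduli of the Hermitian
products of normalised lifts. Once the phases are fixed against a lift of a base point, comparing
the relations at `(x, y)` and `(2x, 2y)` recovers the products themselves (`herm_eq_dot`), so the
isometric embedding is linear.

Thus an `f` preserving a Lagrangian plane through its fixed point is conjugate to a map preserving
`RH2`, and such a map has a real matrix (`exists_real_representative`). The fixed point is a real
negative eigenvector `v` with eigenvalue `l = ±1`. Three distinct eigenvalues of modulus one cannot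
all be real, so there is a nonreal pair `μ`, `conj μ` with conjugate eigenvectors `b`, `conj b`. In
the unitary basis `b, conj b, v`, division by `l` gives `diag(e^{iθ}, e^{-iθ}, 1)`
(`isRealElliptic_of_real`).

Conversely, `diag(e^{iθ}, e^{-iθ}, 1)` is conjugate to the real rotation by `θ`, which preserves
`RH2`. Regularity forces `sin θ ≠ 0`, so the fixed point lies in `RH2` and the square, a rotation by
`2θ`, is not the identity there. -/

/-! ### The Hermitian form and its signature. -/

theorem herm_apply (z w : Fin 3 → ℂ) :
    herm z w = z 0 * star (w 0) + z 1 * star (w 1) - z 2 * star (w 2) := by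
  simp [herm, H, Matrix.mulVec_diagonal, dotProduct, Fin.sum_univ_three]
  ring

theorem herm_add_left (a b c : Fin 3 → ℂ) : herm (a + b) c = herm a c + herm b c := by
  simp [herm_apply]; ring

theorem herm_add_right (a b c : Fin 3 → ℂ) : herm a (b + c) = herm a b + herm a c := by
  simp [herm_apply]; ring

theorem herm_sub_left (a b c : Fin 3 → ℂ) : herm (a - b) c = herm a c - herm b c := by
  simp [herm_apply]; ring

theorem herm_sub_right (a b c : Fin 3 → ℂ) : herm a (b - c) = herm a b - herm a c := by
  simp [herm_apply]; ring

theorem herm_smul_left (k : ℂ) (a c : Fin 3 → ℂ) : herm (k • a) c = k * herm a c := by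
  simp [herm_apply]; ring

theorem herm_smul_right (k : ℂ) (a c : Fin 3 → ℂ) : herm a (k • c) = star k * herm a c := by
  simp [herm_apply]; ring

theorem herm_swap (a b : Fin 3 → ℂ) : herm b a = star (herm a b) := by
  simp [herm_apply]; ring

theorem herm_self_im (a : Fin 3 → ℂ) : (herm a a).im = 0 := by
  simp [herm_apply]; ring

theorem herm_self_eq_re (a : Fin 3 → ℂ) : herm a a = ((herm a a).re : ℂ) :=
  Complex.ext rfl (by simp [herm_self_im])

theorem herm_self_re (a : Fin 3 → ℂ) :
    (herm a a).re = ‖a 0‖ ^ 2 + ‖a 1‖ ^ 2 - ‖a 2‖ ^ 2 := by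
  simp [herm_apply, Complex.sq_norm, Complex.normSq_apply]

/-- The form is positive definite on the orthogonal complement of a negative vector. -/
theorem herm_self_re_pos {n z : Fin 3 → ℂ} (hn : (herm n n).re < 0) (h : herm z n = 0)
    (hz : z ≠ 0) : 0 < (herm z z).re := by
  by_contra! hle
  rw [herm_self_re] at hn hle
  rw [herm_apply, sub_eq_zero] at h
  have h1 : ‖z 2‖ * ‖n 2‖ ≤ ‖z 0‖ * ‖n 0‖ + ‖z 1‖ * ‖n 1‖ := by
    have := norm_add_le (z 0 * star (n 0)) (z 1 * star (n 1))
    rw [h] at this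
    simpa using this
  have h2 : (‖z 2‖ * ‖n 2‖) ^ 2 ≤ (‖z 0‖ * ‖n 0‖ + ‖z 1‖ * ‖n 1‖) ^ 2 := by gcongr
  -- By Cauchy–Schwarz in the two positive coordinates; as `n` is negative, this forces `z 2 = 0`.
  have h3 : ‖z 2‖ ^ 2 * ‖n 2‖ ^ 2 ≤ ‖z 2‖ ^ 2 * (‖n 0‖ ^ 2 + ‖n 1‖ ^ 2) := by
    have : ‖z 2‖ ^ 2 * ‖n 2‖ ^ 2 ≤
        (‖z 0‖ ^ 2 + ‖z 1‖ ^ 2) * (‖n 0‖ ^ 2 + ‖n 1‖ ^ 2) := by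
      nlinarith [sq_nonneg (‖z 0‖ * ‖n 1‖ - ‖z 1‖ * ‖n 0‖)]
    refine this.trans ?_
    gcongr
    linarith
  have h4 : ‖z 2‖ ^ 2 = 0 := by
    by_contra h0
    have : 0 < ‖z 2‖ ^ 2 := lt_of_le_of_ne (sq_nonneg _) (Ne.symm h0)
    have := le_of_mul_le_mul_left h3 this
    linarith
  apply hz
  ext i
  have h5 : ‖z 0‖ ^ 2 = 0 := by nlinarith [sq_nonneg ‖z 0‖, sq_nonneg ‖z 1‖]
  have h6 : ‖z 1‖ ^ 2 = 0 := by nlinarith [sq_nonneg ‖z 0‖, sq_nonneg ‖z 1‖]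
  fin_cases i <;> simp_all

theorem eq_zero_of_herm_self_re_nonpos {n z : Fin 3 → ℂ} (hn : (herm n n).re < 0)
    (h : herm z n = 0) (hz : (herm z z).re ≤ 0) : z = 0 := by
  by_contra h0
  exact absurd (herm_self_re_pos hn h h0) (not_lt.2 hz)

/-- The reversed Cauchy–Schwarz inequality for normalised negative vectors. -/
theorem one_le_norm_herm {a b : Fin 3 → ℂ} (ha : herm a a = -1) (hb : herm b b = -1) :
    1 ≤ ‖herm a b‖ := by
  by_contra! hlt
  -- The projection of `a` to the complement of `b`, with a plus sign because `herm b b = -1`. Its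
  -- norm `‖herm a b‖² - 1` cannot be negative.
  set w := a + herm a b • b with hw
  have h1 : herm w b = 0 := by
    rw [hw, herm_add_left, herm_smul_left, hb]; ring
  have h2 : herm w w = -1 + (‖herm a b‖ ^ 2 : ℝ) := by
    have : herm w w = herm w a := by
      conv_lhs => rw [hw, herm_add_right, herm_smul_right, ← hw, h1]
      simp
    rw [this, hw, herm_add_left, herm_smul_left, ha, herm_swap a b]
    simp [Complex.mul_conj, Complex.normSq_eq_norm_sq]
  have h3 : (herm w w).re < 0 := by
    rw [h2]
    have : ‖herm a b‖ ^ 2 < 1 := by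
      have := norm_nonneg (herm a b)
      nlinarith
    rw [← Complex.ofReal_one, ← Complex.ofReal_neg, ← Complex.ofReal_add, Complex.ofReal_re]
    linarith
  have h4 : w = 0 := eq_zero_of_herm_self_re_nonpos (by rw [hb]; simp) h1 h3.le
  rw [h4] at h3
  simp [herm_apply] at h3

/-! ### Normalised lifts and the distance. -/

theorem ne_zero_of_herm {a : Fin 3 → ℂ} (ha : herm a a ≠ 0) : a ≠ 0 := by
  rintro rfl
  simp [herm_apply] at ha

theorem mk_mem_CH2 {a : Fin 3 → ℂ} (ha : a ≠ 0) :
    Projectivization.mk ℂ a ha ∈ CH2 ↔ (herm a a).re < 0 := by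
  obtain ⟨c, hc⟩ := Projectivization.exists_smul_eq_mk_rep ℂ a ha
  have hc0 : 0 < ‖(c : ℂ)‖ ^ 2 := by have := c.ne_zero; positivity
  have h : (herm ((c : ℂ) • a) ((c : ℂ) • a)).re = ‖(c : ℂ)‖ ^ 2 * (herm a a).re := by
    rw [herm_self_re, herm_self_re]; simp; ring
  change (herm _ _).re < 0 ↔ _
  rw [← hc, Units.smul_def, h]
  constructor
  · intro h'
    by_contra! h2
    exact absurd h' (not_lt.2 (by positivity))
  · exact mul_neg_of_pos_of_neg hc0

/-- Every point of the complex hyperbolic plane has a lift of norm `-1`. -/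
theorem exists_lift {p : CP2} (hp : p ∈ CH2) :
    ∃ (a : Fin 3 → ℂ) (ha : a ≠ 0), herm a a = -1 ∧ p = Projectivization.mk ℂ a ha := by
  have h : (herm p.rep p.rep).re < 0 := hp
  set r := Real.sqrt (-(herm p.rep p.rep).re) with hr
  have hr0 : 0 < r := Real.sqrt_pos.2 (by linarith)
  have hr2 : r ^ 2 = -(herm p.rep p.rep).re := Real.sq_sqrt (by linarith)
  have hrc : (r : ℂ) ≠ 0 := by exact_mod_cast hr0.ne'
  have key : herm ((r⁻¹ : ℂ) • p.rep) ((r⁻¹ : ℂ) • p.rep) = -1 := by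
    rw [herm_smul_left, herm_smul_right, herm_self_eq_re, ← neg_neg (herm p.rep p.rep).re, ← hr2]
    simp
    field_simp
  refine ⟨(r⁻¹ : ℂ) • p.rep, smul_ne_zero (inv_ne_zero hrc) p.rep_nonzero, key, ?_⟩
  conv_lhs => rw [← p.mk_rep]
  rw [Projectivization.mk_eq_mk_iff']
  exact ⟨r, by rw [smul_smul, mul_inv_cancel₀ hrc, one_smul]⟩

theorem bergmanDist_mk {a b : Fin 3 → ℂ} (ha0 : a ≠ 0) (hb0 : b ≠ 0)
    (ha : herm a a = -1) (hb : herm b b = -1) :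
    bergmanDist (Projectivization.mk ℂ a ha0) (Projectivization.mk ℂ b hb0) =
      2 * Real.arcosh ‖herm a b‖ := by
  obtain ⟨c, hc⟩ := Projectivization.exists_smul_eq_mk_rep ℂ a ha0
  obtain ⟨d, hd⟩ := Projectivization.exists_smul_eq_mk_rep ℂ b hb0
  have hc0 := c.ne_zero
  have hd0 := d.ne_zero
  have hc1 : star (c : ℂ) ≠ 0 := star_ne_zero.2 hc0
  have hd1 : star (d : ℂ) ≠ 0 := star_ne_zero.2 hd0
  rw [bergmanDist, ← hc, ← hd, Units.smul_def, Units.smul_def]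
  simp only [herm_smul_left, herm_smul_right, ha, hb]
  have : star (d : ℂ) * ((c : ℂ) * herm a b) * (star (c : ℂ) * ((d : ℂ) * herm b a)) /
      (star (c : ℂ) * ((c : ℂ) * -1) * (star (d : ℂ) * ((d : ℂ) * -1))) =
      ((‖herm a b‖ ^ 2 : ℝ) : ℂ) := by
    rw [herm_swap a b, ← Complex.normSq_eq_norm_sq, ← Complex.mul_conj]
    simp only [Complex.star_def] at *
    field_simp
  rw [this, Complex.ofReal_re, Real.sqrt_sq (norm_nonneg _)]

/-- `arcosh` is injective only on `[1, ∞)`; the reversed Cauchy–Schwarz inequality places both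
moduli there. -/
theorem norm_herm_eq_of_bergmanDist_eq {a b c d : Fin 3 → ℂ} {ha0 : a ≠ 0} {hb0 : b ≠ 0}
    {hc0 : c ≠ 0} {hd0 : d ≠ 0} (ha : herm a a = -1) (hb : herm b b = -1) (hc : herm c c = -1)
    (hd : herm d d = -1)
    (h : bergmanDist (Projectivization.mk ℂ a ha0) (Projectivization.mk ℂ b hb0) =
      bergmanDist (Projectivization.mk ℂ c hc0) (Projectivization.mk ℂ d hd0)) :
    ‖herm a b‖ = ‖herm c d‖ := by
  rw [bergmanDist_mk _ _ ha hb, bergmanDist_mk _ _ hc hd] at h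
  exact Real.arcosh_injOn (one_le_norm_herm ha hb) (one_le_norm_herm hc hd) (by linarith)

/-! ### The unitary group and its action -/

theorem herm_toMat (A : U21) (z w : Fin 3 → ℂ) :
    herm (toMat A *ᵥ z) (toMat A *ᵥ w) = herm z w := by
  have hA : (toMat A)ᴴ * H * toMat A = H := A.2
  rw [herm, Matrix.star_mulVec, ← Matrix.dotProduct_mulVec, Matrix.mulVec_mulVec,
    Matrix.mulVec_mulVec, hA, herm]

theorem toMat_mul (A B : U21) : toMat (A * B) = toMat A * toMat B := by simp [toMat]

theorem toMat_one : toMat 1 = 1 := by simp [toMat]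

theorem toMat_injective : Function.Injective toMat := fun _ _ h =>
  Subtype.ext (Units.ext h)

theorem toMat_mulVec_injective (A : U21) {z w : Fin 3 → ℂ} (h : toMat A *ᵥ z = toMat A *ᵥ w) :
    z = w := by
  have := congrArg (fun v => toMat A⁻¹ *ᵥ v) h
  simpa [Matrix.mulVec_mulVec, ← toMat_mul, toMat_one] using this

theorem toMat_mulVec_ne_zero (A : U21) {z : Fin 3 → ℂ} (hz : z ≠ 0) : toMat A *ᵥ z ≠ 0 :=
  fun h => hz (toMat_mulVec_injective A (by simpa using h))

theorem smul_mk (A : U21) {v : Fin 3 → ℂ} (hv : v ≠ 0) :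
    (A : PU21) • Projectivization.mk ℂ v hv =
      Projectivization.mk ℂ (toMat A *ᵥ v) (toMat_mulVec_ne_zero A hv) := rfl

theorem smul_mem_CH2 (g : PU21) {p : CP2} (hp : p ∈ CH2) : g • p ∈ CH2 := by
  induction g using QuotientGroup.induction_on with
  | H A =>
    obtain ⟨a, ha, haa, rfl⟩ := exists_lift hp
    rw [smul_mk, mk_mem_CH2, herm_toMat, haa]
    simp

theorem bergmanDist_smul (g : PU21) {p q : CP2} (hp : p ∈ CH2) (hq : q ∈ CH2) :
    bergmanDist (g • p) (g • q) = bergmanDist p q := by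
  induction g using QuotientGroup.induction_on with
  | H A =>
    obtain ⟨a, ha, haa, rfl⟩ := exists_lift hp
    obtain ⟨b, hb, hbb, rfl⟩ := exists_lift hq
    rw [smul_mk, smul_mk, bergmanDist_mk _ _ (by rwa [herm_toMat]) (by rwa [herm_toMat]),
      bergmanDist_mk _ _ haa hbb, herm_toMat]

/-- A real hyperbolic plane moved by `PU(2,1)` is a Lagrangian plane. -/
theorem isLagrangianPlane_image (g : PU21) : IsLagrangianPlane ((fun q => g • q) '' RH2) := by
  refine ⟨fun x => ⟨g • x.1, smul_mem_CH2 g x.2.1⟩, fun x y => ?_, ?_⟩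
  · exact bergmanDist_smul g x.2.1 y.2.1
  · ext q
    simp

/-- A basis with Gram matrix `diag(1, 1, -1)` is the image of the standard basis under an element
of `U(2,1)`. -/
theorem exists_toMat_eq {a b c : Fin 3 → ℂ} (haa : herm a a = 1) (hbb : herm b b = 1)
    (hcc : herm c c = -1) (hab : herm a b = 0) (hac : herm a c = 0) (hbc : herm b c = 0) :
    ∃ U : U21, toMat U = (Matrix.of ![a, b, c])ᵀ := by
  set P : Matrix (Fin 3) (Fin 3) ℂ := (Matrix.of ![a, b, c])ᵀ with hP
  have hba : herm b a = 0 := by rw [herm_swap a b, hab]; simp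
  have hca : herm c a = 0 := by rw [herm_swap a c, hac]; simp
  have hcb : herm c b = 0 := by rw [herm_swap b c, hbc]; simp
  have key : Pᴴ * H * P = H := by
    have : ∀ i j, (Pᴴ * H * P) i j = herm (![a, b, c] j) (![a, b, c] i) := by
      intro i j
      rw [Matrix.mul_assoc, herm]
      rfl
    ext i j
    rw [this]
    fin_cases i <;> fin_cases j <;> simp [H, *]
  have hH : H * H = 1 := by
    ext i j
    fin_cases i <;> fin_cases j <;> simp [H]
  have h1 : (H * Pᴴ * H) * P = 1 := by
    rw [Matrix.mul_assoc H, Matrix.mul_assoc H, key, hH]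
  exact ⟨⟨⟨P, H * Pᴴ * H, mul_eq_one_comm.1 h1, h1⟩, key⟩, rfl⟩

theorem of_transpose_mulVec (a b c z : Fin 3 → ℂ) :
    (Matrix.of ![a, b, c])ᵀ *ᵥ z = z 0 • a + z 1 • b + z 2 • c := by
  ext i
  simp [Matrix.mulVec, dotProduct, Fin.sum_univ_three]
  ring

theorem coe_eq_coe_of_toMat {A B : U21} {k : ℂ} (hk : ‖k‖ = 1) (h : toMat B = k • toMat A) :
    (A : PU21) = (B : PU21) := by
  rw [QuotientGroup.eq]
  refine ⟨k, hk, ?_⟩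
  rw [toMat_mul, h, Matrix.mul_smul, ← toMat_mul, inv_mul_cancel, toMat_one]

theorem exists_smul_toMat {A : U21} {k : ℂ} (hk : ‖k‖ = 1) : ∃ B : U21, toMat B = k • toMat A := by
  have hk2 : k * star k = 1 := by
    simp [Complex.mul_conj, Complex.normSq_eq_norm_sq, hk]
  refine ⟨⟨⟨k • toMat A, star k • toMat A⁻¹, ?_, ?_⟩, ?_⟩, rfl⟩
  · rw [Matrix.smul_mul, Matrix.mul_smul, ← toMat_mul, smul_smul, hk2]; simp [toMat_one]
  · rw [Matrix.smul_mul, Matrix.mul_smul, ← toMat_mul, smul_smul, mul_comm, hk2]; simp [toMat_one]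
  · have hA : (toMat A)ᴴ * H * toMat A = H := A.2
    change (k • toMat A)ᴴ * H * (k • toMat A) = H
    rw [Matrix.conjTranspose_smul, Matrix.smul_mul, Matrix.smul_mul, Matrix.mul_smul, smul_smul,
      hA, mul_comm, hk2, one_smul]

theorem exists_toMat_eq_smul {A B : U21} (h : (A : PU21) = (B : PU21)) :
    ∃ k : ℂ, ‖k‖ = 1 ∧ toMat B = k • toMat A := by
  rw [QuotientGroup.eq] at h
  obtain ⟨k, hk, h⟩ := h
  refine ⟨k, hk, ?_⟩
  have : toMat B = toMat A * toMat (A⁻¹ * B) := by rw [← toMat_mul]; simp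
  rw [this, h]
  simp

/-! ### Matrices with three distinct eigenvalues. -/

/-- The matrix has three distinct eigenvalues. -/
def HasThreeEigenvalues (A : U21) : Prop :=
  ∃ μ : Fin 3 → ℂ, Function.Injective μ ∧ ∀ i, ∃ v : Fin 3 → ℂ, v ≠ 0 ∧ toMat A *ᵥ v = μ i • v

theorem HasThreeEigenvalues.of_coe_eq {A B : U21} (hA : HasThreeEigenvalues A)
    (h : (A : PU21) = (B : PU21)) : HasThreeEigenvalues B := by
  obtain ⟨k, hk, h⟩ := exists_toMat_eq_smul h
  obtain ⟨μ, hμ, hv⟩ := hA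
  have hk0 : k ≠ 0 := by rintro rfl; simp at hk
  refine ⟨fun i => k * μ i, fun i j hij => hμ (mul_left_cancel₀ hk0 hij), fun i => ?_⟩
  obtain ⟨v, hv0, hv⟩ := hv i
  exact ⟨v, hv0, by rw [h, Matrix.smul_mulVec, hv, smul_smul]⟩

theorem HasThreeEigenvalues.conj {A : U21} (hA : HasThreeEigenvalues A) (U : U21) :
    HasThreeEigenvalues (U⁻¹ * A * U) := by
  obtain ⟨μ, hμ, hv⟩ := hA
  refine ⟨μ, hμ, fun i => ?_⟩
  obtain ⟨v, hv0, hv⟩ := hv i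
  refine ⟨toMat U⁻¹ *ᵥ v, toMat_mulVec_ne_zero _ hv0, ?_⟩
  rw [Matrix.mulVec_mulVec, ← toMat_mul, mul_assoc, mul_assoc, mul_inv_cancel, mul_one, toMat_mul,
    ← Matrix.mulVec_mulVec, hv, Matrix.mulVec_smul]

theorem IsRegularElliptic.exists_hasThreeEigenvalues {f : PU21} (hf : IsRegularElliptic f) :
    ∃ A : U21, (A : PU21) = f ∧ HasThreeEigenvalues A := by
  obtain ⟨-, A, hA, h⟩ := hf
  refine ⟨A, hA, ?_⟩
  -- `ncard` is `0` on infinite sets, so the value 3 implies finiteness.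
  have hfin : Finite {μ : ℂ | Module.End.HasEigenvalue (Matrix.toLin' (toMat A)) μ} :=
    (Set.finite_of_ncard_ne_zero (by rw [h]; norm_num)).to_subtype
  let e := Finite.equivFinOfCardEq
    (α := {μ : ℂ | Module.End.HasEigenvalue (Matrix.toLin' (toMat A)) μ}) (n := 3) h
  refine ⟨fun i => (e.symm i).1, Subtype.val_injective.comp e.symm.injective, fun i => ?_⟩
  obtain ⟨v, hv⟩ := (e.symm i).2.exists_hasEigenvector
  exact ⟨v, hv.2, by simpa using hv.apply_eq_smul⟩

/-! ### Real vectors -/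

theorem mk_mem_RH2 {z : Fin 3 → ℂ} (hz : z ≠ 0) (hr : ∀ i, (z i).im = 0)
    (hn : (herm z z).re < 0) : Projectivization.mk ℂ z hz ∈ RH2 := by
  have h : (fun i => (((z i).re : ℝ) : ℂ)) = z := by
    ext i
    exact Complex.ext (by simp) (by simp [hr])
  exact ⟨(mk_mem_CH2 hz).2 hn, fun i => (z i).re, by rwa [h], by congr 1; exact h.symm⟩

/-- The point of the upper sheet of the hyperboloid with horizontal coordinates `x`. -/
def sheet (x : ℝ × ℝ) : Fin 3 → ℂ := ![x.1, x.2, (√(1 + x.1 ^ 2 + x.2 ^ 2) : ℝ)]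

theorem sheet_im (x : ℝ × ℝ) (i : Fin 3) : (sheet x i).im = 0 := by
  fin_cases i <;> simp [sheet]

theorem herm_sheet (x y : ℝ × ℝ) : herm (sheet x) (sheet y) =
    ((x.1 * y.1 + x.2 * y.2 - √(1 + x.1 ^ 2 + x.2 ^ 2) * √(1 + y.1 ^ 2 + y.2 ^ 2) : ℝ) : ℂ) := by
  simp [herm_apply, sheet]

theorem herm_sheet_self (x : ℝ × ℝ) : herm (sheet x) (sheet x) = -1 := by
  have h : √(1 + x.1 ^ 2 + x.2 ^ 2) * √(1 + x.1 ^ 2 + x.2 ^ 2) = 1 + x.1 ^ 2 + x.2 ^ 2 :=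
    Real.mul_self_sqrt (by positivity)
  rw [herm_sheet, h]
  push_cast
  ring

theorem sheet_ne_zero (x : ℝ × ℝ) : sheet x ≠ 0 :=
  ne_zero_of_herm (by rw [herm_sheet_self]; simp)

theorem mk_sheet_mem_RH2 (x : ℝ × ℝ) : Projectivization.mk ℂ (sheet x) (sheet_ne_zero x) ∈ RH2 :=
  mk_mem_RH2 _ (sheet_im x) (by rw [herm_sheet_self]; simp)

theorem exists_mk_sheet {p : CP2} (hp : p ∈ RH2) :
    ∃ x, p = Projectivization.mk ℂ (sheet x) (sheet_ne_zero x) := by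
  obtain ⟨hn, x, hx, rfl⟩ := hp
  rw [mk_mem_CH2, herm_self_re] at hn
  simp only [Complex.norm_real, Real.norm_eq_abs, sq_abs] at hn
  set r := √(x 2 ^ 2 - x 0 ^ 2 - x 1 ^ 2) with hr
  have hr0 : 0 < r := Real.sqrt_pos.2 (by linarith)
  have hr2 : r ^ 2 = x 2 ^ 2 - x 0 ^ 2 - x 1 ^ 2 := Real.sq_sqrt (by linarith)
  have h2 : x 2 ≠ 0 := by intro h; rw [h] at hn; nlinarith [sq_nonneg (x 0), sq_nonneg (x 1)]
  -- The modulus of `k` normalises the vector; its sign selects the upper sheet.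
  obtain ⟨k, hk, hk2⟩ : ∃ k : ℝ, k ^ 2 * r ^ 2 = 1 ∧ 0 < k * x 2 := by
    rcases lt_or_gt_of_ne h2 with h | h
    · exact ⟨-r⁻¹, by field_simp, by have := inv_pos.2 hr0; nlinarith⟩
    · exact ⟨r⁻¹, by field_simp, by positivity⟩
  have hs : √(1 + (k * x 0) ^ 2 + (k * x 1) ^ 2) = k * x 2 := by
    rw [Real.sqrt_eq_iff_mul_self_eq_of_pos hk2]
    rw [hr2] at hk
    linarith
  refine ⟨(k * x 0, k * x 1), ?_⟩
  symm
  rw [Projectivization.mk_eq_mk_iff']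
  refine ⟨k, ?_⟩
  ext i
  fin_cases i <;> simp [sheet, hs]

/-! ### Lagrangian planes are linear -/

/-- Removes the phase ambiguity of a lift: `herm g N` is made equal to `herm (sheet x) (sheet 0)`,
with `N` in the role of `sheet 0`. -/
theorem exists_normalised_lift {N : Fin 3 → ℂ} (hN : N ≠ 0) (hNN : herm N N = -1) {p : CP2}
    (hp : p ∈ CH2) {x : ℝ × ℝ}
    (hd : bergmanDist p (Projectivization.mk ℂ N hN) =
      bergmanDist (Projectivization.mk ℂ (sheet x) (sheet_ne_zero x))
        (Projectivization.mk ℂ (sheet 0) (sheet_ne_zero 0))) :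
    ∃ (g : Fin 3 → ℂ) (hg : g ≠ 0), herm g g = -1 ∧ p = Projectivization.mk ℂ g hg ∧
      herm g N = ((-√(1 + x.1 ^ 2 + x.2 ^ 2) : ℝ) : ℂ) := by
  obtain ⟨a, ha, haa, rfl⟩ := exists_lift hp
  have h := norm_herm_eq_of_bergmanDist_eq haa hNN (herm_sheet_self x) (herm_sheet_self 0) hd
  have hpos : 0 < √(1 + x.1 ^ 2 + x.2 ^ 2) := Real.sqrt_pos.2 (by positivity)
  rw [herm_sheet, Complex.norm_real] at h
  simp only [Prod.fst_zero, Prod.snd_zero] at h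
  norm_num at h
  rw [abs_of_pos hpos] at h
  set t := √(1 + x.1 ^ 2 + x.2 ^ 2) with ht
  have hw0 : herm a N ≠ 0 := by rw [← norm_pos_iff, h]; exact hpos
  set k : ℂ := ((-t : ℝ) : ℂ) / herm a N with hk
  have hk1 : ‖k‖ = 1 := by
    rw [hk, norm_div, h, Complex.norm_real, norm_neg, Real.norm_of_nonneg hpos.le,
      div_self hpos.ne']
  have hk0 : k ≠ 0 := by rw [← norm_pos_iff, hk1]; exact one_pos
  refine ⟨k • a, smul_ne_zero hk0 ha, ?_, ?_, ?_⟩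
  · rw [herm_smul_left, herm_smul_right, haa, ← mul_assoc, Complex.star_def, Complex.mul_conj,
      Complex.normSq_eq_norm_sq, hk1]
    simp
  · symm
    rw [Projectivization.mk_eq_mk_iff']
    exact ⟨k, rfl⟩
  · rw [herm_smul_left, hk, div_mul_cancel₀ _ hw0]

theorem dot_le_sqrt_mul_sqrt (x y : ℝ × ℝ) :
    x.1 * y.1 + x.2 * y.2 ≤ √(1 + x.1 ^ 2 + x.2 ^ 2) * √(1 + y.1 ^ 2 + y.2 ^ 2) := by
  rw [← Real.sqrt_mul (by positivity)]
  apply Real.le_sqrt_of_sq_le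
  nlinarith [sq_nonneg (x.1 * y.2 - x.2 * y.1), sq_nonneg x.1, sq_nonneg x.2, sq_nonneg y.1,
    sq_nonneg y.2]

theorem herm_real_smul_left (k : ℝ) (a c : Fin 3 → ℂ) :
    herm ((k : ℂ) • a) c = k * herm a c := herm_smul_left _ _ _

theorem herm_real_smul_right (k : ℝ) (a c : Fin 3 → ℂ) :
    herm a ((k : ℂ) • c) = k * herm a c := by rw [herm_smul_right]; simp

/-- A map into the orthogonal complement of a negative vector that satisfies the distance relations
of the real hyperbolic plane preserves scalar products. -/
theorem herm_eq_dot {N : Fin 3 → ℂ} (hN : herm N N = -1) {Z : ℝ × ℝ → Fin 3 → ℂ}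
    (hZN : ∀ x, herm (Z x) N = 0)
    (hZZ : ∀ x, herm (Z x) (Z x) = ((x.1 ^ 2 + x.2 ^ 2 : ℝ) : ℂ))
    (hZ : ∀ x y, ‖herm (Z x) (Z y) -
        ((√(1 + x.1 ^ 2 + x.2 ^ 2) * √(1 + y.1 ^ 2 + y.2 ^ 2) : ℝ) : ℂ)‖ =
      |x.1 * y.1 + x.2 * y.2 - √(1 + x.1 ^ 2 + x.2 ^ 2) * √(1 + y.1 ^ 2 + y.2 ^ 2)|)
    (x y : ℝ × ℝ) : herm (Z x) (Z y) = ((x.1 * y.1 + x.2 * y.2 : ℝ) : ℂ) := by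
  have hNneg : (herm N N).re < 0 := by rw [hN]; simp
  -- From `T - Re w ≤ |w - T| = T - x·y`, where `w` is the product and `T` the product of the roots.
  have hre : ∀ x y : ℝ × ℝ, x.1 * y.1 + x.2 * y.2 ≤ (herm (Z x) (Z y)).re := by
    intro x y
    have h := hZ x y
    rw [abs_of_nonpos (sub_nonpos.2 (dot_le_sqrt_mul_sqrt x y))] at h
    have h2 := (neg_le_abs _).trans (Complex.abs_re_le_norm (herm (Z x) (Z y) -
        ((√(1 + x.1 ^ 2 + x.2 ^ 2) * √(1 + y.1 ^ 2 + y.2 ^ 2) : ℝ) : ℂ)))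
    rw [h, Complex.sub_re, Complex.ofReal_re] at h2
    linarith
  -- By the lower bound, `Z (2x) - 2 Z x` has norm at most `8|x|² - 8|x|² = 0`, and the form is
  -- positive definite on the complement of `N`.
  have hdouble : ∀ x : ℝ × ℝ, Z ((2 : ℝ) • x) = ((2 : ℝ) : ℂ) • Z x := by
    intro x
    rw [← sub_eq_zero]
    apply eq_zero_of_herm_self_re_nonpos hNneg
    · rw [herm_sub_left, herm_real_smul_left, hZN, hZN]; simp
    · have h1 := hre ((2 : ℝ) • x) x
      have h2 : (herm (Z x) (Z ((2 : ℝ) • x))).re = (herm (Z ((2 : ℝ) • x)) (Z x)).re := by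
        rw [herm_swap]; simp
      simp only [herm_sub_left, herm_sub_right, herm_real_smul_left, herm_real_smul_right, hZZ,
        Complex.sub_re, Complex.re_ofReal_mul, Complex.ofReal_re, h2]
      simp only [Prod.smul_fst, Prod.smul_snd, smul_eq_mul] at h1 ⊢
      nlinarith
  have h1 := hZ x y
  have h2 := hZ ((2 : ℝ) • x) ((2 : ℝ) • y)
  have h3 := hre x y
  rw [hdouble, hdouble, herm_real_smul_left, herm_real_smul_right] at h2
  simp only [Prod.smul_fst, Prod.smul_snd, smul_eq_mul] at h2
  have hlt : ∀ x : ℝ × ℝ, √(1 + (2 * x.1) ^ 2 + (2 * x.2) ^ 2) < 2 * √(1 + x.1 ^ 2 + x.2 ^ 2) := by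
    intro x
    have h0 : 0 < √(1 + x.1 ^ 2 + x.2 ^ 2) := Real.sqrt_pos.2 (by positivity)
    rw [Real.sqrt_lt' (by positivity), mul_pow 2 (√_), Real.sq_sqrt (by positivity)]
    linarith
  have h4 : √(1 + (2 * x.1) ^ 2 + (2 * x.2) ^ 2) * √(1 + (2 * y.1) ^ 2 + (2 * y.2) ^ 2) <
      4 * (√(1 + x.1 ^ 2 + x.2 ^ 2) * √(1 + y.1 ^ 2 + y.2 ^ 2)) := by
    have := mul_lt_mul'' (hlt x) (hlt y) (Real.sqrt_nonneg _) (Real.sqrt_nonneg _)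
    linarith
  generalize √(1 + x.1 ^ 2 + x.2 ^ 2) * √(1 + y.1 ^ 2 + y.2 ^ 2) = T at h1 h4
  generalize √(1 + (2 * x.1) ^ 2 + (2 * x.2) ^ 2) * √(1 + (2 * y.1) ^ 2 + (2 * y.2) ^ 2) = S
    at h2 h4
  generalize herm (Z x) (Z y) = w at h1 h2 h3 ⊢
  have e1 := congrArg (· ^ 2) h1
  have e2 := congrArg (· ^ 2) h2
  simp only [Complex.sq_norm, Complex.normSq_apply, sq_abs, Complex.sub_re, Complex.sub_im,
    Complex.re_ofReal_mul, Complex.im_ofReal_mul, Complex.ofReal_re, Complex.ofReal_im] at e1 e2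
  have e4 : w.re = x.1 * y.1 + x.2 * y.2 := by
    -- The two squared relations share the unknown `|w|²`; eliminating it leaves a linear equation
    -- for `Re w`, solvable since `S < 4T`.
    have e3 : (4 * T - S) * (w.re - (x.1 * y.1 + x.2 * y.2)) = 0 := by
      linear_combination (e2 - 16 * e1) / 8
    rcases mul_eq_zero.1 e3 with h | h <;> linarith
  refine Complex.ext (by rw [Complex.ofReal_re, e4]) ?_
  rw [e4] at e1
  rw [Complex.ofReal_im]
  nlinarith

/-- Lifts of the image split as `G x = Z x + τ x • N` with `Z x` orthogonal to `N`. Since `Z`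
preserves scalar products it is linear, and `Z (1,0)`, `Z (0,1)`, `N` are the columns of the
required unitary matrix. -/
theorem IsLagrangianPlane.exists_eq_image {L : Set CP2} (hL : IsLagrangianPlane L) :
    ∃ U : U21, L = (fun q => (U : PU21) • q) '' RH2 := by
  obtain ⟨φ, hφ, rfl⟩ := hL
  let m : ℝ × ℝ → RH2 := fun x => ⟨Projectivization.mk ℂ (sheet x) (sheet_ne_zero x),
    mk_sheet_mem_RH2 x⟩
  obtain ⟨N, hN, hNN, hNφ⟩ := exists_lift (φ (m 0)).2
  have hG : ∀ x, ∃ (g : Fin 3 → ℂ) (hg : g ≠ 0), herm g g = -1 ∧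
      (φ (m x) : CP2) = Projectivization.mk ℂ g hg ∧
      herm g N = ((-√(1 + x.1 ^ 2 + x.2 ^ 2) : ℝ) : ℂ) := fun x =>
    exists_normalised_lift hN hNN (φ (m x)).2 (by rw [← hNφ]; exact hφ (m x) (m 0))
  choose G hG0 hGG hGφ hGN using hG
  have hd : ∀ x y, ‖herm (G x) (G y)‖ = ‖herm (sheet x) (sheet y)‖ := fun x y =>
    norm_herm_eq_of_bergmanDist_eq (hGG x) (hGG y) (herm_sheet_self x) (herm_sheet_self y)
      (ha0 := hG0 x) (hb0 := hG0 y) (hc0 := sheet_ne_zero x) (hd0 := sheet_ne_zero y)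
      (by rw [← hGφ, ← hGφ]; exact hφ (m x) (m y))
  set τ : ℝ × ℝ → ℝ := fun x => √(1 + x.1 ^ 2 + x.2 ^ 2) with hτ
  have hτ2 : ∀ x, τ x * τ x = 1 + x.1 ^ 2 + x.2 ^ 2 := fun x => Real.mul_self_sqrt (by positivity)
  set Z : ℝ × ℝ → Fin 3 → ℂ := fun x => G x - (τ x : ℂ) • N with hZ
  have hNG : ∀ x, herm N (G x) = ((-τ x : ℝ) : ℂ) := fun x => by
    rw [herm_swap (G x) N, hGN, Complex.star_def, Complex.conj_ofReal]
  have hZN : ∀ x, herm (Z x) N = 0 := fun x => by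
    simp only [hZ, herm_sub_left, herm_real_smul_left, hNN, hGN]
    push_cast
    ring
  have hZdot : ∀ x y, herm (Z x) (Z y) = herm (G x) (G y) + ((τ x * τ y : ℝ) : ℂ) := fun x y => by
    simp only [hZ, herm_sub_left, herm_sub_right, herm_real_smul_left, herm_real_smul_right, hNN,
      hGN, hNG]
    push_cast
    ring
  have key : ∀ x y, herm (Z x) (Z y) = ((x.1 * y.1 + x.2 * y.2 : ℝ) : ℂ) := by
    apply herm_eq_dot hNN hZN
    · intro x
      rw [hZdot, hGG, hτ2]
      push_cast
      ring
    · intro x y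
      rw [hZdot]
      rw [add_sub_cancel_right, hd, herm_sheet, Complex.norm_real, Real.norm_eq_abs]
  obtain ⟨U, hU⟩ := exists_toMat_eq (a := Z (1, 0)) (b := Z (0, 1)) (c := N) (by simp [key])
    (by simp [key]) hNN (by simp [key]) (hZN _) (hZN _)
  have hlin : ∀ x, Z x = (x.1 : ℂ) • Z (1, 0) + (x.2 : ℂ) • Z (0, 1) := by
    intro x
    rw [← sub_eq_zero]
    apply eq_zero_of_herm_self_re_nonpos (n := N) (by rw [hNN]; simp)
    · simp only [herm_sub_left, herm_add_left, herm_smul_left, hZN]; simp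
    · simp only [herm_sub_left, herm_add_left, herm_real_smul_left, herm_sub_right, herm_add_right,
        herm_real_smul_right, key]
      norm_cast
      simp
  have hUsheet : ∀ x, toMat U *ᵥ sheet x = G x := by
    intro x
    have : G x = Z x + (τ x : ℂ) • N := by simp [hZ]
    rw [hU, of_transpose_mulVec, this, hlin x]
    simp [sheet, hτ]
  have hφU : ∀ x, (φ (m x) : CP2) = (U : PU21) • (m x : CP2) := by
    intro x
    rw [hGφ, smul_mk]
    congr 1
    exact (hUsheet x).symm
  refine ⟨U, ?_⟩
  have : ∀ q : RH2, (φ q : CP2) = (U : PU21) • (q : CP2) := by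
    rintro ⟨q, hq⟩
    obtain ⟨x, rfl⟩ := exists_mk_sheet hq
    exact hφU x
  ext q
  simp [this]

/-! ### Isometries preserving the real hyperbolic plane -/

theorem exists_smul_sheet_of_smul_mk_mem {A : U21} {z : Fin 3 → ℂ} (hz : z ≠ 0)
    (h : (A : PU21) • Projectivization.mk ℂ z hz ∈ RH2) :
    ∃ (c : ℂ) (x : ℝ × ℝ), toMat A *ᵥ z = c • sheet x := by
  obtain ⟨x, hx⟩ := exists_mk_sheet h
  rw [smul_mk, Projectivization.mk_eq_mk_iff'] at hx
  obtain ⟨c, hc⟩ := hx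
  exact ⟨c, x, hc.symm⟩

theorem im_smul_eq_zero {c : ℂ} {z : Fin 3 → ℂ} (hc : c.im = 0) (hz : ∀ i, (z i).im = 0)
    (i : Fin 3) : ((c • z) i).im = 0 := by
  simp [hc, hz]

theorem im_mulVec_eq_zero {M : Matrix (Fin 3) (Fin 3) ℂ} (hM : ∀ i j, (M i j).im = 0)
    {z : Fin 3 → ℂ} (hz : ∀ i, (z i).im = 0) (i : Fin 3) : ((M *ᵥ z) i).im = 0 := by
  simp [Matrix.mulVec, dotProduct, Fin.sum_univ_three, hM, hz]

/-- An element of `PU(2,1)` that maps the real hyperbolic plane into itself is represented by a real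
matrix. -/
theorem exists_real_representative {f : PU21} (hf : ∀ q ∈ RH2, f • q ∈ RH2) :
    ∃ A : U21, (A : PU21) = f ∧ ∀ i j, (toMat A i j).im = 0 := by
  obtain ⟨B, rfl⟩ := QuotientGroup.mk_surjective f
  obtain ⟨c, x, hc⟩ := exists_smul_sheet_of_smul_mk_mem (sheet_ne_zero 0)
    (hf _ (mk_sheet_mem_RH2 0))
  have hc1 : ‖c‖ = 1 := by
    have h := herm_toMat B (sheet 0) (sheet 0)
    rw [hc, herm_smul_left, herm_smul_right, herm_sheet_self, herm_sheet_self, ← mul_assoc,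
      Complex.star_def, Complex.mul_conj, Complex.normSq_eq_norm_sq] at h
    have h' : ‖c‖ ^ 2 = 1 := by
      have : ((‖c‖ ^ 2 : ℝ) : ℂ) = 1 := by linear_combination -h
      exact_mod_cast this
    nlinarith [norm_nonneg c]
  have hc0 : c ≠ 0 := by rintro rfl; simp at hc1
  -- Rescaling by `c⁻¹` makes the image of `sheet 0` real; this fixes the phase of the whole matrix.
  obtain ⟨A, hA⟩ := exists_smul_toMat (A := B) (k := c⁻¹) (by rw [norm_inv, hc1, inv_one])
  have hAB : (A : PU21) = B := (coe_eq_coe_of_toMat (by rw [norm_inv, hc1, inv_one]) hA).symm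
  refine ⟨A, hAB, ?_⟩
  rw [← hAB] at hf
  have hA0 : toMat A *ᵥ sheet 0 = sheet x := by
    rw [hA, Matrix.smul_mulVec, hc, smul_smul, inv_mul_cancel₀ hc0, one_smul]
  -- The image is `d • sheet y`. Invariance of the product with `sheet 0` gives `d * s = -z 2` with
  -- `s` real and nonzero, hence `d` is real.
  have key : ∀ (z : Fin 3 → ℂ), (∀ i, (z i).im = 0) → (herm z z).re < 0 → z 2 ≠ 0 →
      ∀ i, ((toMat A *ᵥ z) i).im = 0 := by
    intro z hz hn hz2
    have hz0 : z ≠ 0 := by rintro rfl; simp at hz2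
    obtain ⟨d, y, hd⟩ := exists_smul_sheet_of_smul_mk_mem hz0 (hf _ (mk_mem_RH2 hz0 hz hn))
    have h := herm_toMat A z (sheet 0)
    rw [hA0, hd, herm_smul_left, herm_sheet] at h
    have h0 : herm z (sheet 0) = ((-(z 2).re : ℝ) : ℂ) := by
      have : z 2 = ((z 2).re : ℂ) := Complex.ext (by simp) (by simp [hz])
      simp [herm_apply, sheet]
      exact this
    rw [h0] at h
    generalize y.1 * x.1 + y.2 * x.2 - √(1 + y.1 ^ 2 + y.2 ^ 2) * √(1 + x.1 ^ 2 + x.2 ^ 2) = s at h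
    have h1 := congrArg Complex.re h
    have h2 := congrArg Complex.im h
    simp only [Complex.re_mul_ofReal, Complex.im_mul_ofReal, Complex.ofReal_re,
      Complex.ofReal_im] at h1 h2
    have hs : s ≠ 0 := by
      rintro rfl
      apply hz2
      exact Complex.ext (by simpa using h1.symm) (by simp [hz])
    rw [hd]
    exact im_smul_eq_zero ((mul_eq_zero.1 h2).resolve_right hs) (sheet_im y)
  have h2 : ∀ i, (toMat A i 2).im = 0 := by
    intro i
    have := key ![0, 0, 1] (by intro i; fin_cases i <;> simp)
      (by simp [herm_self_re]) (by simp) i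
    simpa [Matrix.mulVec, dotProduct, Fin.sum_univ_three] using this
  have h0 : ∀ i, (toMat A i 0).im = 0 := by
    intro i
    -- The standard basis vector is not negative; adding twice the last one makes it so, and the
    -- last column is already known to be real.
    have := key ![1, 0, 2] (by intro i; fin_cases i <;> simp)
      (by simp [herm_self_re]) (by simp) i
    simpa [Matrix.mulVec, dotProduct, Fin.sum_univ_three, h2] using this
  have h1 : ∀ i, (toMat A i 1).im = 0 := by
    intro i
    have := key ![0, 1, 2] (by intro i; fin_cases i <;> simp)
      (by simp [herm_self_re]) (by simp) i
    simpa [Matrix.mulVec, dotProduct, Fin.sum_univ_three, h2] using this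
  intro i j
  fin_cases j
  exacts [h0 i, h1 i, h2 i]

/-! ### Eigenvectors of real unitary matrices. -/

theorem star_mulVec_of_real {M : Matrix (Fin 3) (Fin 3) ℂ} (hM : ∀ i j, (M i j).im = 0)
    (z : Fin 3 → ℂ) : M *ᵥ star z = star (M *ᵥ z) := by
  have h : ∀ i j, (starRingEnd ℂ) (M i j) = M i j := fun i j =>
    Complex.conj_eq_iff_im.2 (hM i j)
  ext i
  simp [Matrix.mulVec, dotProduct, h]

theorem herm_star_star (a b : Fin 3 → ℂ) : herm (star a) (star b) = herm b a := by
  simp [herm_apply]; ring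

/-- Invariance of the form gives `(μ * star ν - 1) * herm a b = 0`. -/
theorem herm_eq_zero_of_eigenvectors {A : U21} {a b : Fin 3 → ℂ} {μ ν : ℂ}
    (ha : toMat A *ᵥ a = μ • a) (hb : toMat A *ᵥ b = ν • b) (h : μ * star ν ≠ 1) :
    herm a b = 0 := by
  have h1 := herm_toMat A a b
  rw [ha, hb, herm_smul_left, herm_smul_right] at h1
  have h2 : (μ * star ν - 1) * herm a b = 0 := by linear_combination h1
  exact (mul_eq_zero.1 h2).resolve_left (sub_ne_zero.2 h)

theorem norm_eigenvalue_eq_one {A : U21} {a : Fin 3 → ℂ} {μ : ℂ}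
    (ha : toMat A *ᵥ a = μ • a) (h : herm a a ≠ 0) : ‖μ‖ = 1 := by
  by_contra hμ
  refine h (herm_eq_zero_of_eigenvectors ha ha fun h1 => hμ ?_)
  rw [Complex.star_def, Complex.mul_conj, Complex.normSq_eq_norm_sq] at h1
  have h2 : ‖μ‖ ^ 2 = 1 := by exact_mod_cast h1
  nlinarith [norm_nonneg μ]

/-- A real matrix with three distinct eigenvalues and a real negative eigenvector is real
elliptic. -/
theorem isRealElliptic_of_real {A : U21} (hA : ∀ i j, (toMat A i j).im = 0)
    (h3 : HasThreeEigenvalues A) {p : CP2} (hp : p ∈ RH2) (hAp : (A : PU21) • p = p) :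
    IsRealElliptic (A : PU21) := by
  obtain ⟨x, rfl⟩ := exists_mk_sheet hp
  rw [smul_mk, Projectivization.mk_eq_mk_iff'] at hAp
  obtain ⟨l, hl⟩ := hAp
  set v := sheet x with hv
  have hvv : herm v v = -1 := herm_sheet_self x
  have hvneg : (herm v v).re < 0 := by rw [hvv]; simp
  have hvr : ∀ i, (v i).im = 0 := sheet_im x
  have hstarv : star v = v := by
    ext i
    exact Complex.conj_eq_iff_im.2 (hvr i)
  have hl1 : ‖l‖ = 1 := norm_eigenvalue_eq_one hl.symm (by rw [hvv]; simp)
  have hlim : l.im = 0 := by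
    have h1 := star_mulVec_of_real hA v
    rw [hstarv, ← hl, star_smul, hstarv] at h1
    have h2 : (l - star l) • v = 0 := by rw [sub_smul, ← h1, sub_self]
    have h3 := (smul_eq_zero.1 h2).resolve_right (sheet_ne_zero x)
    exact Complex.conj_eq_iff_im.1 (sub_eq_zero.1 h3).symm
  have hll : l * l = 1 := by
    have := Complex.mul_conj l
    rw [Complex.conj_eq_iff_im.2 hlim, Complex.normSq_eq_norm_sq, hl1] at this
    simpa using this
  obtain ⟨μ, hμ, hev⟩ := h3
  choose a ha0 ha using hev
  -- Since `l` is real and `l² = 1`, the equation `μ * star l = 1` means `μ = l`.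
  have horth : ∀ i, μ i ≠ l → herm (a i) v = 0 := fun i hi =>
    herm_eq_zero_of_eigenvectors (ha i) hl.symm (by
      rw [Complex.star_def, Complex.conj_eq_iff_im.2 hlim]
      intro h
      exact hi (mul_right_cancel₀ (b := l) (by rintro rfl; simp at hll) (h.trans hll.symm)))
  have hpos : ∀ i, μ i ≠ l → 0 < (herm (a i) (a i)).re := fun i hi =>
    herm_self_re_pos hvneg (horth i hi) (ha0 i)
  have hnorm : ∀ i, ‖μ i‖ = 1 := by
    intro i
    by_cases hi : μ i = l
    · rw [hi, hl1]
    · exact norm_eigenvalue_eq_one (ha i) fun h => by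
        have := hpos i hi
        simp [h] at this
  obtain ⟨i, hi⟩ : ∃ i, (μ i).im ≠ 0 := by
    by_contra! hall
    have hsq : ∀ i, μ i = 1 ∨ μ i = -1 := by
      intro i
      have := Complex.mul_conj (μ i)
      rw [Complex.conj_eq_iff_im.2 (hall i), Complex.normSq_eq_norm_sq, hnorm i] at this
      exact mul_self_eq_one_iff.1 (by simpa using this)
    have h01 : μ 0 ≠ μ 1 := hμ.ne (by decide)
    have h02 : μ 0 ≠ μ 2 := hμ.ne (by decide)
    have h12 : μ 1 ≠ μ 2 := hμ.ne (by decide)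
    rcases hsq 0 with h0 | h0 <;> rcases hsq 1 with h1 | h1 <;> rcases hsq 2 with h2 | h2 <;>
      simp_all
  have hil : μ i ≠ l := fun h => hi (by rw [h, hlim])
  set r := √(herm (a i) (a i)).re with hr
  have hr0 : 0 < r := Real.sqrt_pos.2 (hpos i hil)
  have hr2 : r ^ 2 = (herm (a i) (a i)).re := Real.sq_sqrt (hpos i hil).le
  have hrc : (r : ℂ) ≠ 0 := by exact_mod_cast hr0.ne'
  set b : Fin 3 → ℂ := ((r⁻¹ : ℝ) : ℂ) • a i with hb
  have hbb : herm b b = 1 := by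
    rw [hb, herm_real_smul_left, herm_real_smul_right, herm_self_eq_re, ← hr2]
    push_cast
    field_simp
  have hbμ : toMat A *ᵥ b = μ i • b := by
    rw [hb, Matrix.mulVec_smul, ha, smul_comm]
  have hbμ' : toMat A *ᵥ star b = star (μ i) • star b := by
    rw [star_mulVec_of_real hA, hbμ, star_smul]
  have hbv : herm b v = 0 := by rw [hb, herm_smul_left, horth i hil, mul_zero]
  have hbv' : herm (star b) v = 0 := by
    rw [← hstarv, herm_star_star, herm_swap b v, hbv, star_zero]
  -- The exceptional case is `μ² = 1`, excluded because `μ` is not real.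
  have hbb' : herm b (star b) = 0 := herm_eq_zero_of_eigenvectors hbμ hbμ' (by
    rw [star_star]
    intro h
    rcases mul_self_eq_one_iff.1 h with h | h <;> simp [h] at hi)
  obtain ⟨P, hP⟩ := exists_toMat_eq hbb (by rwa [herm_star_star]) hvv hbb' hbv hbv'
  have hlμ : ‖l * μ i‖ = 1 := by rw [norm_mul, hl1, hnorm, one_mul]
  -- Multiplication by `l = l⁻¹` turns the eigenvalue on `v` into 1.
  set θ := (l * μ i).arg with hθ
  have hexp : Complex.exp (θ * Complex.I) = l * μ i := by
    have := Complex.norm_mul_exp_arg_mul_I (l * μ i)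
    rwa [hlμ, Complex.ofReal_one, one_mul] at this
  have hexp' : Complex.exp (-(θ * Complex.I)) = l * star (μ i) := by
    have := congrArg (starRingEnd ℂ) hexp
    rw [← Complex.exp_conj] at this
    simpa [Complex.conj_eq_iff_im.2 hlim] using this
  have hR : toMat (realEllipticMatrix θ) =
      Matrix.diagonal ![l * μ i, l * star (μ i), 1] := by
    rw [← hexp, ← hexp']; rfl
  have hmul : toMat (A * P) = l • toMat (P * realEllipticMatrix θ) := by
    rw [toMat_mul, toMat_mul, hR]
    have hcol : toMat A * toMat P = (Matrix.of ![μ i • b, star (μ i) • star b, l • v])ᵀ := by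
      rw [← hbμ, ← hbμ', hl, hP]
      ext j k
      fin_cases k <;> simp [Matrix.mul_apply, Matrix.mulVec, dotProduct]
    rw [hcol, hP]
    ext j k
    fin_cases k
    · simp; linear_combination (-(μ i * b j)) * hll
    · simp; linear_combination (-((starRingEnd ℂ) (μ i) * (starRingEnd ℂ) (b j))) * hll
    · simp
  refine ⟨θ, ?_⟩
  rw [isConj_iff]
  refine ⟨(P : PU21), ?_⟩
  have := coe_eq_coe_of_toMat hl1 hmul
  rw [mul_inv_eq_iff_eq_mul]
  simpa using this

/-! ### Rotations of the real hyperbolic plane -/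

theorem exists_rotation (θ : ℝ) : ∃ B : U21, toMat B =
    (Matrix.of ![![(Real.cos θ : ℂ), (Real.sin θ : ℂ), 0],
      ![-(Real.sin θ : ℂ), (Real.cos θ : ℂ), 0],
      ![0, 0, 1]])ᵀ := by
  have h : ((Real.cos θ : ℝ) : ℂ) * (Real.cos θ : ℝ) + (Real.sin θ : ℝ) * (Real.sin θ : ℝ) = 1 := by
    norm_cast
    nlinarith [Real.sin_sq_add_cos_sq θ]
  apply exists_toMat_eq <;> simp only [herm_apply] <;>
    simp only [Matrix.cons_val, Complex.star_def, Complex.conj_ofReal, map_neg, map_zero, map_one]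
  · linear_combination h
  · linear_combination h
  all_goals ring

/-- The rotation by `θ` as an element of `U(2,1)`. -/
def rotation (θ : ℝ) : U21 := (exists_rotation θ).choose

theorem rotation_mulVec (θ : ℝ) (z : Fin 3 → ℂ) : toMat (rotation θ) *ᵥ z =
    ![Real.cos θ * z 0 - Real.sin θ * z 1, Real.sin θ * z 0 + Real.cos θ * z 1, z 2] := by
  rw [rotation, (exists_rotation θ).choose_spec, of_transpose_mulVec]
  ext i
  fin_cases i <;> simp <;> ring

theorem rotation_im (θ : ℝ) (i j : Fin 3) : (toMat (rotation θ) i j).im = 0 := by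
  rw [rotation, (exists_rotation θ).choose_spec]
  fin_cases i <;> fin_cases j <;> simp only [Matrix.transpose_apply, Matrix.of_apply] <;>
    simp [-Complex.ofReal_cos, -Complex.ofReal_sin]

theorem smul_mem_RH2_of_real {A : U21} (hA : ∀ i j, (toMat A i j).im = 0) {q : CP2}
    (hq : q ∈ RH2) : (A : PU21) • q ∈ RH2 := by
  obtain ⟨x, rfl⟩ := exists_mk_sheet hq
  rw [smul_mk]
  exact mk_mem_RH2 _ (im_mulVec_eq_zero hA (sheet_im x))
    (by rw [herm_toMat, herm_sheet_self]; simp)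

theorem ext_mulVec {A B : U21} (h : ∀ z, toMat A *ᵥ z = toMat B *ᵥ z) : A = B :=
  toMat_injective (Matrix.ext_of_mulVec_single fun _ => h _)

theorem rotation_mul_rotation_neg (θ : ℝ) : rotation θ * rotation (-θ) = 1 := by
  have h : ((Real.cos θ : ℝ) : ℂ) * (Real.cos θ : ℝ) + (Real.sin θ : ℝ) * (Real.sin θ : ℝ) = 1 := by
    norm_cast
    nlinarith [Real.sin_sq_add_cos_sq θ]
  apply ext_mulVec
  intro z
  rw [toMat_mul, ← Matrix.mulVec_mulVec, rotation_mulVec, rotation_mulVec, toMat_one,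
    Matrix.one_mulVec, Real.cos_neg, Real.sin_neg]
  ext i
  fin_cases i <;> simp only [Matrix.cons_val, Fin.zero_eta, Fin.mk_one, Fin.reduceFinMk,
    Complex.ofReal_neg]
  · linear_combination z 0 * h
  · linear_combination z 1 * h

theorem image_rotation_RH2 (θ : ℝ) : (fun q => ((rotation θ : U21) : PU21) • q) '' RH2 = RH2 := by
  apply Set.Subset.antisymm
  · rintro _ ⟨q, hq, rfl⟩
    exact smul_mem_RH2_of_real (rotation_im θ) hq
  · intro q hq
    refine ⟨((rotation (-θ) : U21) : PU21) • q, smul_mem_RH2_of_real (rotation_im (-θ)) hq, ?_⟩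
    simp only [smul_smul]
    rw [← QuotientGroup.mk_mul, rotation_mul_rotation_neg, QuotientGroup.mk_one, one_smul]

/-- The rotation multiplies `z₀ ± i z₁` by `e^{±iθ}`; the factor `1/√2` makes this change of
coordinates unitary. -/
theorem isConj_rotation_realEllipticMatrix (θ : ℝ) :
    IsConj (rotation θ) (realEllipticMatrix θ) := by
  set s : ℂ := (((√2)⁻¹ : ℝ) : ℂ) with hs
  have hss : s * s = 1 / 2 := by
    rw [hs, ← Complex.ofReal_mul, ← mul_inv, Real.mul_self_sqrt (by norm_num)]
    norm_num
  have hsc : star s = s := Complex.conj_ofReal _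
  obtain ⟨U, hU⟩ := exists_toMat_eq (a := ![s, s, 0]) (b := ![s * Complex.I, -(s * Complex.I), 0])
    (c := ![0, 0, 1]) (by simp [herm_apply] ; simp [← Complex.star_def, hsc, hss]; norm_num)
    (by
      simp [herm_apply]; simp [← Complex.star_def, hsc]
      linear_combination 2 * hss - 2 * s ^ 2 * Complex.I_sq)
    (by simp [herm_apply]) (by simp [herm_apply]) (by simp [herm_apply]) (by simp [herm_apply])
  rw [isConj_iff]
  refine ⟨U, ?_⟩
  rw [mul_inv_eq_iff_eq_mul]
  apply ext_mulVec
  intro z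
  rw [toMat_mul, toMat_mul, ← Matrix.mulVec_mulVec, ← Matrix.mulVec_mulVec, rotation_mulVec, hU,
    of_transpose_mulVec, of_transpose_mulVec]
  change _ = Matrix.diagonal _ *ᵥ _
  rw [← neg_mul (θ : ℂ), Complex.exp_mul_I, Complex.exp_mul_I, Complex.cos_neg, Complex.sin_neg]
  ext i
  rw [Matrix.mulVec_diagonal]
  fin_cases i <;> simp
  · linear_combination (-s * z 1 * Complex.sin θ) * Complex.I_sq
  · linear_combination (-s * z 1 * Complex.sin θ) * Complex.I_sq

/-- If `sin θ = 0`, the rotation is diagonal with at most two distinct entries, `cos θ` and 1. -/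
theorem sin_ne_zero_of_hasThreeEigenvalues {θ : ℝ} (h : HasThreeEigenvalues (rotation θ)) :
    Real.sin θ ≠ 0 := by
  intro hs
  obtain ⟨μ, hμ, hev⟩ := h
  have key : ∀ i, μ i = Real.cos θ ∨ μ i = 1 := by
    intro i
    obtain ⟨v, hv0, hv⟩ := hev i
    rw [rotation_mulVec, hs] at hv
    by_contra! hne
    apply hv0
    have e0 := congrFun hv 0
    have e1 := congrFun hv 1
    have e2 := congrFun hv 2
    simp only [Matrix.cons_val, Pi.smul_apply, smul_eq_mul, Complex.ofReal_zero] at e0 e1 e2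
    have c0 : (μ i - Real.cos θ) * v 0 = 0 := by linear_combination -e0
    have c1 : (μ i - Real.cos θ) * v 1 = 0 := by linear_combination -e1
    have c2 : (μ i - 1) * v 2 = 0 := by linear_combination -e2
    ext j
    fin_cases j
    · exact (mul_eq_zero.1 c0).resolve_left (sub_ne_zero.2 hne.1)
    · exact (mul_eq_zero.1 c1).resolve_left (sub_ne_zero.2 hne.1)
    · exact (mul_eq_zero.1 c2).resolve_left (sub_ne_zero.2 hne.2)
  have h01 : μ 0 ≠ μ 1 := hμ.ne (by decide)
  have h02 : μ 0 ≠ μ 2 := hμ.ne (by decide)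
  have h12 : μ 1 ≠ μ 2 := hμ.ne (by decide)
  rcases key 0 with h0 | h0 <;> rcases key 1 with h1 | h1 <;> rcases key 2 with h2 | h2 <;>
    simp_all

theorem mem_RH2_of_rotation_smul_eq {θ : ℝ} (hθ : Real.sin θ ≠ 0) {p : CP2} (hp : p ∈ CH2)
    (h : ((rotation θ : U21) : PU21) • p = p) : p ∈ RH2 := by
  obtain ⟨a, ha, haa, rfl⟩ := exists_lift hp
  rw [smul_mk, Projectivization.mk_eq_mk_iff'] at h
  obtain ⟨c, hc⟩ := h
  rw [rotation_mulVec] at hc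
  have e0 := congrFun hc 0
  have e1 := congrFun hc 1
  have e2 := congrFun hc 2
  simp only [Matrix.cons_val, Pi.smul_apply, smul_eq_mul] at e0 e1 e2
  have ha2 : a 2 ≠ 0 := by
    intro h2
    have := congrArg Complex.re haa
    rw [herm_self_re, h2] at this
    norm_num at this
    nlinarith [sq_nonneg ‖a 0‖, sq_nonneg ‖a 1‖]
  have hc1 : c = 1 := mul_right_cancel₀ ha2 (by rw [e2, one_mul])
  subst hc1
  -- The determinant of the rotation minus the identity on the first two coordinates; the fixed
  -- point is therefore the origin of the ball.
  have hdet : (((1 - Real.cos θ) ^ 2 + Real.sin θ ^ 2 : ℝ) : ℂ) ≠ 0 := by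
    have : 0 < (1 - Real.cos θ) ^ 2 + Real.sin θ ^ 2 := by positivity
    exact_mod_cast this.ne'
  push_cast at hdet e0 e1
  have c0 : a 0 = 0 := by
    refine (mul_eq_zero.1 (?_ : _ * a 0 = 0)).resolve_left hdet
    linear_combination (1 - Complex.cos θ) * e0 - Complex.sin θ * e1
  have c1 : a 1 = 0 := by
    refine (mul_eq_zero.1 (?_ : _ * a 1 = 0)).resolve_left hdet
    linear_combination (1 - Complex.cos θ) * e1 + Complex.sin θ * e0
  have : Projectivization.mk ℂ a ha = Projectivization.mk ℂ (sheet 0) (sheet_ne_zero 0) := by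
    rw [Projectivization.mk_eq_mk_iff']
    refine ⟨a 2, ?_⟩
    ext i
    fin_cases i <;> simp [sheet, c0, c1]
  rw [this]
  exact mk_sheet_mem_RH2 0

/-- The square rotates by `2θ`; fixing the point over `(1, 0)` would give `cos² θ - sin² θ = 1`, so
`sin θ = 0`. -/
theorem not_isInvolutionOn_rotation {θ : ℝ} (hθ : Real.sin θ ≠ 0) :
    ¬ IsInvolutionOn ((rotation θ : U21) : PU21) RH2 := by
  intro h
  have h1 := h _ (mk_sheet_mem_RH2 (1, 0))
  rw [smul_mk, smul_mk, Projectivization.mk_eq_mk_iff'] at h1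
  obtain ⟨c, hc⟩ := h1
  rw [rotation_mulVec, rotation_mulVec] at hc
  have e0 := congrFun hc 0
  have e2 := congrFun hc 2
  simp only [sheet, Matrix.cons_val, Pi.smul_apply, smul_eq_mul] at e0 e2
  have hs : ((√(1 + 1 ^ 2 + 0 ^ 2) : ℝ) : ℂ) ≠ 0 := by
    have : 0 < √(1 + 1 ^ 2 + 0 ^ 2 : ℝ) := Real.sqrt_pos.2 (by norm_num)
    exact_mod_cast this.ne'
  have hc1 : c = 1 := mul_right_cancel₀ hs (by rw [e2, one_mul])
  rw [hc1, one_mul] at e0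
  norm_cast at e0
  apply hθ
  have := Real.sin_sq_add_cos_sq θ
  have h4 : Real.sin θ ^ 2 = 0 := by nlinarith
  simpa using h4

end ComplexHyperbolic

/-! ### The two implications. -/

open ComplexHyperbolic in
theorem exists_isLagrangianPlane_of_isRealElliptic {f : PU21} (hf : IsRegularElliptic f)
    {p : CP2} (hp : p ∈ CH2) (hfp : f • p = p) (h : IsRealElliptic f) :
    ∃ L : Set CP2, IsLagrangianPlane L ∧ p ∈ L ∧
        (fun q => f • q) '' L = L ∧ ¬ IsInvolutionOn f L := by
  obtain ⟨θ, hθ⟩ := h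
  have hconj := ((QuotientGroup.mk' unitScalars).map_isConj
    (isConj_rotation_realEllipticMatrix θ)).trans hθ
  rw [isConj_iff] at hconj
  obtain ⟨g, hg⟩ := hconj
  simp only [QuotientGroup.mk'_apply] at hg
  obtain ⟨A, hA, h3⟩ := hf.exists_hasThreeEigenvalues
  have h3' : HasThreeEigenvalues (rotation θ) := by
    obtain ⟨G, rfl⟩ := QuotientGroup.mk_surjective g
    apply (h3.conj G).of_coe_eq
    rw [QuotientGroup.mk_mul, QuotientGroup.mk_mul, hA, ← hg, QuotientGroup.mk_inv]
    group
  have hsin := sin_ne_zero_of_hasThreeEigenvalues h3'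
  set R : PU21 := ((rotation θ : U21) : PU21) with hR
  have hfg : ∀ q : CP2, f • g • q = g • R • q := by
    intro q
    rw [← hg, smul_smul, smul_smul]
    congr 1
    group
  have hpR : R • g⁻¹ • p = g⁻¹ • p := by
    rw [eq_inv_smul_iff, ← hfg, smul_inv_smul, hfp]
  -- The plane is `RH2` moved by the element `g` that conjugates the rotation to `f`; it contains
  -- `p` because `g⁻¹ • p` is fixed by the rotation.
  refine ⟨(fun q => g • q) '' RH2, isLagrangianPlane_image g,
    ⟨g⁻¹ • p, mem_RH2_of_rotation_smul_eq hsin (smul_mem_CH2 _ hp) hpR, smul_inv_smul g p⟩, ?_, ?_⟩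
  · conv_rhs => rw [← image_rotation_RH2 θ]
    rw [Set.image_image, Set.image_image]
    simp only [hfg, hR]
  · intro hinv
    apply not_isInvolutionOn_rotation hsin
    intro q hq
    have := hinv (g • q) ⟨q, hq, rfl⟩
    rw [hfg, hfg] at this
    exact smul_left_cancel g this

open ComplexHyperbolic in
theorem isRealElliptic_of_isLagrangianPlane {f : PU21} (hf : IsRegularElliptic f)
    {p : CP2} (hfp : f • p = p) {L : Set CP2} (hL : IsLagrangianPlane L)
    (hpL : p ∈ L) (hfL : (fun q => f • q) '' L = L) : IsRealElliptic f := by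
  obtain ⟨U, rfl⟩ := hL.exists_eq_image
  obtain ⟨A, rfl, h3⟩ := hf.exists_hasThreeEigenvalues
  -- Conjugation by `U` carries the given plane back to `RH2`, where the real representative is
  -- available.
  set f' : PU21 := ((U⁻¹ * A * U : U21) : PU21) with hf'
  have hfU : ∀ q : CP2, (U : PU21) • f' • q = (A : PU21) • (U : PU21) • q := by
    intro q
    rw [smul_smul, smul_smul, hf', ← QuotientGroup.mk_mul, ← QuotientGroup.mk_mul]
    congr 2
    group
  obtain ⟨q, hq, rfl⟩ := hpL
  have hmaps : ∀ q ∈ RH2, f' • q ∈ RH2 := by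
    intro q hq
    have : (A : PU21) • (U : PU21) • q ∈ (fun q => (U : PU21) • q) '' RH2 := by
      rw [← hfL]
      exact ⟨_, ⟨q, hq, rfl⟩, rfl⟩
    obtain ⟨q', hq', h⟩ := this
    rw [← hfU] at h
    rwa [← smul_left_cancel _ h]
  obtain ⟨B, hB, hBr⟩ := exists_real_representative hmaps
  obtain ⟨θ, hθ⟩ := isRealElliptic_of_real hBr ((h3.conj U).of_coe_eq hB.symm) hq (by
    rw [hB]
    apply smul_left_cancel (U : PU21)
    rw [hfU]
    exact hfp)
  refine ⟨θ, hθ.trans ?_⟩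
  rw [hB, isConj_iff]
  refine ⟨(U : PU21), ?_⟩
  rw [hf', ← QuotientGroup.mk_inv, ← QuotientGroup.mk_mul, ← QuotientGroup.mk_mul]
  congr 1
  group

end

theorem mainTheorem5 (f : ComplexHyperbolic.PU21) (hf : ComplexHyperbolic.IsRegularElliptic f)
    (p : ComplexHyperbolic.CP2) (hp : p ∈ ComplexHyperbolic.CH2) (hfp : f • p = p) :
    ComplexHyperbolic.IsRealElliptic f ↔
      ∃ L : Set ComplexHyperbolic.CP2, ComplexHyperbolic.IsLagrangianPlane L ∧ p ∈ L ∧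
        (fun q => f • q) '' L = L ∧ ¬ ComplexHyperbolic.IsInvolutionOn f L :=
  ⟨exists_isLagrangianPlane_of_isRealElliptic hf hp hfp,
    fun ⟨_, hL, hpL, hfL, _⟩ => isRealElliptic_of_isLagrangianPlane hf hfp hL hpL hfL⟩
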